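/- Let $K$ be a finite field, $F_r$ the free group on $r$ generators, and let $\theta_k\colon F_r\to GL(n_k,K)$ ($k\ge 1$, $n_k\ge 1$) be a sequence of linear representations. Extend each $\theta_k$ to the group algebra $KF_r$ and, entrywise, to matrices; for $A\in \mathrm{Mat}_{m\times m}(KF_r)$ put $\mathrm{rk}^m_{n_k}(\theta_k(A))=\mathrm{Rank}_K(\theta_k(A))/n_k$, where $\theta_k(A)$ is viewed as an $mn_k\times mn_k$ matrix over $K$. Suppose that the sequence is convergent, i.e. $\lim_{k\to\infty}\mathrm{rk}^m_{n_k}(\theta_k(A))$ exists for all $m\ge 1$ and $A\in \mathrm{Mat}_{m\times m}(KF_r)$, and that it satisfies the Atiyah condition, i.e. all these limits are integers. For a skew field $D$ over $K$ (that is, containing $K$ in its center), a homomorphism $\theta\colon F_r\to D^\times$ is called a limit of the sequence if $\lim_{k\to\infty}\mathrm{rk}^m_{n_k}(\theta_k(A))=\mathrm{rk}_D(\theta(A))$ for all $m\ge1$ and $A\in \mathrm{Mat}_{m\times m}(KF_r)$, where $\mathrm{rk}_D$ is the usual rank of matrices over $D$; it is called generating if $D$ is the smallest skew subfield of $D$ that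 contains $K$ and $\mathrm{Im}\,\theta$. Then there exist a countable skew field $D$ over $K$ and a generating limit $\theta\colon F_r\to D^\times$ of the sequence. If $\theta'\colon F_r\to (D')^\times$ is another generating limit into a skew field $D'$ over $K$, then there is an isomorphism of $K$-algebras $\pi\colon D\to D'$ with $\pi\circ\theta=\theta'$. Moreover, for every nonprincipal ultrafilter $\omega$ on the positive integers, let $\mathcal M=\prod_k \mathrm{Mat}_{n_k\times n_k}(K)/\{(a_k): \lim_\omega \mathrm{Rank}(a_k)/n_k=0\}$ and let $\hat\theta\colon F_r\to\mathcal M^\times$, $\hat\theta(g)=[(\theta_k(g))_k]$, also extended to $KF_r$. Then there is an isomorphism of $K$-algebras $e$ from $D$ onto the division closure of $\hat\theta(KF_r)$ in $\mathcal M$ (the smallest subring of $\mathcal M$ that contains $\hat\theta(KF_r)$ and contains the inverse of each of its elements that is invertible in $\mathcal M$), with $e\circ\theta=\hat\theta$. In particular this division closure is a skew field. -/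

import Mathlib

universe u v

open Filter Topology

noncomputable section

namespace FreeGroupLimit

/-- The `K`-algebra homomorphism `K[G] →ₐ[K] A` extending a homomorphism from the group `G` into
the group of invertible elements of the `K`-algebra `A`. -/
def extend (K : Type*) [Field K] {G A : Type*} [Group G] [Ring A] [Algebra K A] (θ : G →* Aˣ) :
    MonoidAlgebra K G →ₐ[K] A :=
  MonoidAlgebra.lift K A G ((Units.coeHom A).comp θ)

/-- For a representation `θ` of `G` on `K^n` and an `m × m` matrix `A` over the group algebra, the
normalized rank `Rank (θ(A)) / n`, where `θ(A)` is an `m × m` matrix of `n × n` blocks, read as an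
`mn × mn` matrix over `K`. -/
def normalizedRank {K : Type*} [Field K] {G : Type*} [Group G] {n : ℕ}
    (θ : G →* (Matrix (Fin n) (Fin n) K)ˣ) {m : ℕ}
    (A : Matrix (Fin m) (Fin m) (MonoidAlgebra K G)) : ℝ :=
  ((Matrix.comp (Fin m) (Fin m) (Fin n) (Fin n) K (A.map (extend K θ))).rank : ℝ) / (n : ℝ)

/-- The rank of a square matrix over a skew field: the dimension of the left vector space spanned
by its rows (equivalently, of the right vector space spanned by its columns). This is the matrix
rank function of a skew field. -/
def skewRank {D : Type*} [DivisionRing D] {m : ℕ} (A : Matrix (Fin m) (Fin m) D) : ℕ :=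
  Module.finrank D (Submodule.span D (Set.range A.row))

section Sequence

variable {K : Type*} [Field K] {G : Type*} [Group G] {n : ℕ → ℕ}

/-- A sequence of representations is convergent if the normalized ranks of all square matrices over
the group algebra converge. -/
def IsConvergent (θ : ∀ k, G →* (Matrix (Fin (n k)) (Fin (n k)) K)ˣ) : Prop :=
  ∀ (m : ℕ) (A : Matrix (Fin m) (Fin m) (MonoidAlgebra K G)),
    ∃ l : ℝ, Tendsto (fun k => normalizedRank (θ k) A) atTop (𝓝 l)

/-- The Atiyah condition: the limits of the normalized ranks are integers. -/
def AtiyahCondition (θ : ∀ k, G →* (Matrix (Fin (n k)) (Fin (n k)) K)ˣ) : Prop :=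
  ∀ (m : ℕ) (A : Matrix (Fin m) (Fin m) (MonoidAlgebra K G)),
    ∃ z : ℤ, Tendsto (fun k => normalizedRank (θ k) A) atTop (𝓝 (z : ℝ))

/-- A homomorphism `ρ` into the multiplicative group of a skew field `D` over `K` is a limit of the
sequence `θ` if the normalized ranks of `θ k (A)` converge to the rank of `ρ(A)` over `D`, for all
square matrices `A` over the group algebra. -/
def IsLimit (θ : ∀ k, G →* (Matrix (Fin (n k)) (Fin (n k)) K)ˣ)
    {D : Type*} [DivisionRing D] [Algebra K D] (ρ : G →* Dˣ) : Prop :=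
  ∀ (m : ℕ) (A : Matrix (Fin m) (Fin m) (MonoidAlgebra K G)),
    Tendsto (fun k => normalizedRank (θ k) A) atTop (𝓝 (skewRank (A.map (extend K ρ)) : ℝ))

end Sequence

/-- The image of `ρ` generates `D` as a skew field over `K`: no proper skew subfield of `D`
contains the image of the group algebra. (`Subfield` is Mathlib's notion of a division subring of
a division ring.) -/
def Generates (K : Type*) [Field K] {G : Type*} [Group G]
    {D : Type*} [DivisionRing D] [Algebra K D] (ρ : G →* Dˣ) : Prop :=
  Subfield.closure (Set.range (extend K ρ)) = ⊤

/-- The division closure of a subset of a `K`-algebra `S`: the smallest `K`-subalgebra of `S`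
that contains the subset and contains the inverses of those of its elements that are invertible
in `S`. -/
def divisionClosure (K : Type*) [Field K] {S : Type*} [Ring S] [Algebra K S] (X : Set S) :
    Subalgebra K S :=
  sInf {T : Subalgebra K S | X ⊆ T ∧ ∀ x : Sˣ, (x : S) ∈ T → ((x⁻¹ : Sˣ) : S) ∈ T}

section Ultraproduct

theorem rank_add_le {K : Type*} [Field K] {d : ℕ} (a b : Matrix (Fin d) (Fin d) K) :
    (a + b).rank ≤ a.rank + b.rank := by
  unfold Matrix.rank
  rw [Matrix.mulVecLin_add]
  exact (Submodule.finrank_mono (LinearMap.range_add_le _ _)).trans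
    (Submodule.finrank_add_le_finrank_add_finrank _ _)

variable (K : Type u) [Field K] (n : ℕ → ℕ) (ω : Ultrafilter ℕ)

/-- The ideal of the sequences of matrices whose normalized rank has ultralimit zero. -/
def rankIdeal : Ideal (∀ k, Matrix (Fin (n k)) (Fin (n k)) K) where
  carrier := {a | Tendsto (fun k => ((a k).rank : ℝ) / (n k : ℝ)) (ω : Filter ℕ) (𝓝 0)}
  zero_mem' := by simp
  add_mem' := by
    intro a b ha hb
    refine squeeze_zero (fun k => by positivity) (fun k => ?_) (by simpa using ha.add hb)
    rw [← add_div]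
    gcongr
    exact_mod_cast rank_add_le (a k) (b k)
  smul_mem' := by
    intro c a ha
    refine squeeze_zero (fun k => by positivity) (fun k => ?_) ha
    have h : ((c k * a k).rank : ℝ) ≤ (a k).rank := by
      exact_mod_cast Matrix.rank_mul_le_right (c k) (a k)
    exact div_le_div_of_nonneg_right h (Nat.cast_nonneg _)

instance rankIdeal_isTwoSided : (rankIdeal K n ω).IsTwoSided where
  mul_mem_of_left := by
    intro a c ha
    refine squeeze_zero (fun k => by positivity) (fun k => ?_) ha
    have h : ((a k * c k).rank : ℝ) ≤ (a k).rank := by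
      exact_mod_cast Matrix.rank_mul_le_left (a k) (c k)
    exact div_le_div_of_nonneg_right h (Nat.cast_nonneg _)

/-- The ultraproduct of the matrix algebras `Mat_{n k × n k}(K)` with respect to their normalized
rank functions. -/
abbrev Ultraproduct : Type u := (∀ k, Matrix (Fin (n k)) (Fin (n k)) K) ⧸ rankIdeal K n ω

variable {K n}

/-- The homomorphism `g ↦ [(θ k g)_k]` into the group of invertible elements of the
ultraproduct. -/
def ultraproductRep {G : Type*} [Group G] (θ : ∀ k, G →* (Matrix (Fin (n k)) (Fin (n k)) K)ˣ) :
    G →* (Ultraproduct K n ω)ˣ :=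
  MonoidHom.toHomUnits
    (((Ideal.Quotient.mk (rankIdeal K n ω)) :
        (∀ k, Matrix (Fin (n k)) (Fin (n k)) K) →* Ultraproduct K n ω).comp
      (MonoidHom.pi fun k => (Units.coeHom _).comp (θ k)))

end Ultraproduct

end FreeGroupLimit

end

/-! For a nonprincipal `ω`, the `ω`-limit of normalized ranks is a rank function on matrices over
the ultraproduct. On matrices over the group algebra it takes the limit values of the sequence,
hence integers. Every element of the division closure is rational, that is, of the form `x = u A⁻¹
v` with `A`, `u`, `v` over the group algebra and `A` invertible over the ultraproduct. Elimination
turns `A` bordered by `v`, `u` and `0` into `diag(A, -x)`, so the bordered matrix has rank `m + rk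
x` (`IsRealization.ultraRank_bordered`). Thus `rk x` is an integer in `[0, 1]`: rank `0` forces `x =
0`, rank `1` forces `x` to be a unit, and the division closure is a skew field
(`isUnit_or_eq_zero_of_isRational`). Any homomorphism from a skew field to the ultraproduct carries
the skew rank to the ultraproduct rank (`ultraRank_map_eq_skewRank`), so this skew field is a limit.

For uniqueness, two limits make the same matrices invertible. By the bordering trick, a rational
element of `D × D'` over the diagonal map has both coordinates zero or both nonzero, so the rational
closure is the graph of an isomorphism (`exists_algEquiv_of_isUnit_iff`). Uniqueness also identifies
the division closures for different ultrafilters. -/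

noncomputable section

namespace FreeGroupLimit

/-! ### Rational closure: linear realizations `u A⁻¹ v` and bordered matrices. -/

section Realization

open Matrix

theorem isUnit_fromBlocks_diag_iff {S ι κ : Type*} [Ring S] [Fintype ι] [DecidableEq ι]
    [Fintype κ] [DecidableEq κ] {A : Matrix ι ι S} {D : Matrix κ κ S} :
    IsUnit (fromBlocks A 0 0 D) ↔ IsUnit A ∧ IsUnit D := by
  constructor
  · intro h
    obtain ⟨X, hX, hX'⟩ := isUnit_iff_exists.1 h
    rw [← fromBlocks_toBlocks X, fromBlocks_multiply, ← fromBlocks_one, fromBlocks_inj] at hX hX'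
    simp only [Matrix.zero_mul, Matrix.mul_zero, add_zero, zero_add] at hX hX'
    exact ⟨isUnit_iff_exists.2 ⟨_, hX.1, hX'.1⟩,
      isUnit_iff_exists.2 ⟨_, hX.2.2.2, hX'.2.2.2⟩⟩
  · rintro ⟨hA, hD⟩
    obtain ⟨A', h1, h2⟩ := isUnit_iff_exists.1 hA
    obtain ⟨D', h3, h4⟩ := isUnit_iff_exists.1 hD
    refine isUnit_iff_exists.2 ⟨fromBlocks A' 0 0 D', ?_, ?_⟩ <;>
    simp [fromBlocks_multiply, h1, h2, h3, h4]

theorem isUnit_fromBlocks_upper_unipotent {S ι κ : Type*} [Ring S] [Fintype ι] [DecidableEq ι]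
    [Fintype κ] [DecidableEq κ] (B : Matrix ι κ S) :
    IsUnit (fromBlocks 1 B 0 1 : Matrix (ι ⊕ κ) (ι ⊕ κ) S) :=
  isUnit_iff_exists.2 ⟨fromBlocks 1 (-B) 0 1, by simp [fromBlocks_multiply],
    by simp [fromBlocks_multiply]⟩

theorem isUnit_fromBlocks_lower_unipotent {S ι κ : Type*} [Ring S] [Fintype ι] [DecidableEq ι]
    [Fintype κ] [DecidableEq κ] (C : Matrix κ ι S) :
    IsUnit (fromBlocks 1 0 C 1 : Matrix (ι ⊕ κ) (ι ⊕ κ) S) :=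
  isUnit_iff_exists.2 ⟨fromBlocks 1 0 (-C) 1, by simp [fromBlocks_multiply],
    by simp [fromBlocks_multiply]⟩

theorem isUnit_fromBlocks_upper {S ι κ : Type*} [Ring S] [Fintype ι] [DecidableEq ι]
    [Fintype κ] [DecidableEq κ] {A : Matrix ι ι S} {D : Matrix κ κ S} (hA : IsUnit A)
    (hD : IsUnit D) (B : Matrix ι κ S) : IsUnit (fromBlocks A B 0 D) := by
  obtain ⟨A', h1, h2⟩ := isUnit_iff_exists.1 hA
  have : fromBlocks A B 0 D = fromBlocks A 0 0 D * fromBlocks 1 (A' * B) 0 1 := by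
    simp [fromBlocks_multiply, ← Matrix.mul_assoc, h1]
  rw [this]
  exact (isUnit_fromBlocks_diag_iff.2 ⟨hA, hD⟩).mul (isUnit_fromBlocks_upper_unipotent _)

variable {R S T : Type*} [Ring R] [Ring S] [Ring T]

/-- The element `x` of `S` equals `u A⁻¹ v`, where `A` is a matrix over `R` that becomes invertible
over `S` and `u`, `v` are a row and a column over `R`. -/
def IsRealization {ι : Type*} [Fintype ι] [DecidableEq ι] (f : R →+* S) (A : Matrix ι ι R)
    (u v : ι → R) (x : S) : Prop :=
  IsUnit (A.map f) ∧ ∃ w : ι → S, A.map f *ᵥ w = f ∘ v ∧ x = (f ∘ u) ⬝ᵥ w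

/-- The matrix `A` bordered by the column `v`, the row `u` and the corner `0`. -/
def bordered {ι : Type*} (A : Matrix ι ι R) (u v : ι → R) :
    Matrix (ι ⊕ Fin 1) (ι ⊕ Fin 1) R :=
  fromBlocks A (replicateCol (Fin 1) v) (replicateRow (Fin 1) u) 0

variable {ι : Type*} [Fintype ι] [DecidableEq ι] {f : R →+* S} {A : Matrix ι ι R}
  {u v : ι → R} {x : S}

theorem IsRealization.map (h : IsRealization f A u v x) (p : S →+* T) :
    IsRealization (p.comp f) A u v (p x) := by
  obtain ⟨hA, w, hw, rfl⟩ := h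
  refine ⟨?_, p ∘ w, ?_, ?_⟩
  · have := hA.map p.mapMatrix
    simpa [RingHom.mapMatrix_apply, Matrix.map_map] using this
  · have := congrArg (fun z => p ∘ z) hw
    ext i
    have := congrFun this i
    simpa [mulVec, dotProduct] using this
  · simp [dotProduct]

/-- Block elimination with pivot `A`: the Schur complement of the corner is `0 - u A⁻¹ v = -x`. This
reduces questions about `x` to a matrix over `R`. -/
theorem IsRealization.bordered_map_eq (h : IsRealization f A u v x) :
    ∃ L U : Matrix (ι ⊕ Fin 1) (ι ⊕ Fin 1) S, IsUnit L ∧ IsUnit U ∧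
      (bordered A u v).map f = L * fromBlocks (A.map f) 0 0 (scalar (Fin 1) (-x)) * U := by
  obtain ⟨hA, w, hw, rfl⟩ := h
  obtain ⟨A', h1, h2⟩ := isUnit_iff_exists.1 hA
  refine ⟨_, _, isUnit_fromBlocks_lower_unipotent (replicateRow (Fin 1) (f ∘ u) * A'),
    isUnit_fromBlocks_upper_unipotent (replicateCol (Fin 1) w), ?_⟩
  rw [bordered, fromBlocks_map, fromBlocks_multiply, fromBlocks_multiply, fromBlocks_inj]
  refine ⟨by simp, ?_, ?_, ?_⟩
  · ext i j
    simpa [mul_apply, mulVec, dotProduct] using (congrFun hw i).symm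
  · rw [Matrix.mul_assoc _ A', h2]
    ext i j
    simp
  · rw [Matrix.mul_assoc _ A', h2]
    ext i j
    fin_cases i
    fin_cases j
    simp [mul_apply, dotProduct]

theorem isUnit_scalar_fin_one {x : S} : IsUnit (scalar (Fin 1) x) ↔ IsUnit x := by
  constructor
  · intro h
    obtain ⟨X, h1, h2⟩ := isUnit_iff_exists.1 h
    refine isUnit_iff_exists.2 ⟨X 0 0, ?_, ?_⟩
    · simpa [mul_apply] using congrFun (congrFun h1 0) 0
    · simpa [mul_apply] using congrFun (congrFun h2 0) 0
  · exact fun h => h.map (scalar (Fin 1))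

theorem IsRealization.isUnit_bordered_iff (h : IsRealization f A u v x) :
    IsUnit ((bordered A u v).map f) ↔ IsUnit x := by
  obtain ⟨L, U, hL, hU, he⟩ := h.bordered_map_eq
  lift L to (Matrix (ι ⊕ Fin 1) (ι ⊕ Fin 1) S)ˣ using hL
  lift U to (Matrix (ι ⊕ Fin 1) (ι ⊕ Fin 1) S)ˣ using hU
  rw [he, Units.isUnit_mul_units, Units.isUnit_units_mul, isUnit_fromBlocks_diag_iff,
    isUnit_scalar_fin_one, IsUnit.neg_iff]
  exact and_iff_right h.1

theorem IsRealization.reindex {κ : Type*} [Fintype κ] [DecidableEq κ] (e : ι ≃ κ)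
    (h : IsRealization f A u v x) :
    IsRealization f (Matrix.reindex e e A) (u ∘ e.symm) (v ∘ e.symm) x := by
  obtain ⟨hA, w, hw, rfl⟩ := h
  refine ⟨?_, w ∘ e.symm, ?_, ?_⟩
  · have := hA.map (reindexRingEquiv S e)
    exact this
  · ext k
    have := congrFun hw (e.symm k)
    rw [reindex_apply, ← submatrix_map]
    rw [submatrix_mulVec_equiv]
    simpa [Function.comp_assoc] using this
  · exact (Equiv.sum_comp e.symm (fun i => f (u i) * w i)).symm

omit [Ring R] in
theorem isUnit_map_reindex_iff {κ : Type*} [Fintype κ] [DecidableEq κ] (e : ι ≃ κ)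
    (A : Matrix ι ι R) (g : R → S) : IsUnit ((Matrix.reindex e e A).map g) ↔ IsUnit (A.map g) := by
  change IsUnit (reindexRingEquiv S e (A.map g)) ↔ _
  exact MulEquiv.isUnit_map _

variable (f) in
/-- The rational closure of the image of `f`, as a predicate. -/
def IsRational (x : S) : Prop :=
  ∃ (m : ℕ) (A : Matrix (Fin m) (Fin m) R) (u v : Fin m → R), IsRealization f A u v x

theorem IsRealization.isRational (h : IsRealization f A u v x) : IsRational f x :=
  ⟨_, _, _, _, h.reindex (Fintype.equivFin ι)⟩

theorem isRational_apply (f : R →+* S) (r : R) : IsRational f (f r) :=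
  IsRealization.isRational (ι := Fin 1) (A := 1) (u := fun _ => 1) (v := fun _ => r)
    ⟨by simp, fun _ => f r, by ext; simp, by simp [dotProduct]⟩

theorem IsRational.neg (hx : IsRational f x) : IsRational f (-x) := by
  obtain ⟨m, A, u, v, hA, w, hw, rfl⟩ := hx
  refine ⟨m, A, -u, v, hA, w, hw, ?_⟩
  rw [← neg_dotProduct]
  congr 1
  ext
  simp

theorem IsRational.add {y : S} (hx : IsRational f x) (hy : IsRational f y) :
    IsRational f (x + y) := by
  obtain ⟨m, A, u, v, hA, w, hw, rfl⟩ := hx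
  obtain ⟨m', A', u', v', hA', w', hw', rfl⟩ := hy
  refine IsRealization.isRational (A := fromBlocks A 0 0 A') (u := Sum.elim u u')
    (v := Sum.elim v v') ⟨?_, Sum.elim w w', ?_, ?_⟩
  · rw [fromBlocks_map]
    simpa using isUnit_fromBlocks_diag_iff.2 ⟨hA, hA'⟩
  · rw [fromBlocks_map, fromBlocks_mulVec]
    simp [hw, hw', Sum.comp_elim]
  · simp [Sum.comp_elim]

theorem IsRational.mul {y : S} (hx : IsRational f x) (hy : IsRational f y) :
    IsRational f (x * y) := by
  obtain ⟨m, A, u, v, hA, w, hw, rfl⟩ := hx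
  obtain ⟨m', A', u', v', hA', w', hw', rfl⟩ := hy
  -- The corner `-v u'` makes back substitution feed the scalar `u' w' = y` into the first system,
  -- whose solution becomes `w y`.
  refine IsRealization.isRational (A := fromBlocks A (-(vecMulVec v u')) 0 A')
    (u := Sum.elim u 0) (v := Sum.elim 0 v')
    ⟨?_, Sum.elim (fun i => w i * ((f ∘ u') ⬝ᵥ w')) w', ?_, ?_⟩
  · rw [fromBlocks_map]
    simpa using isUnit_fromBlocks_upper hA hA' _
  · rw [fromBlocks_map, fromBlocks_mulVec, Sum.comp_elim]
    congr 1
    · ext i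
      have h := congrFun hw i
      simp only [mulVec, dotProduct, Function.comp_apply, Matrix.map_apply] at h
      simp [mulVec, dotProduct, vecMulVec_apply, ← mul_assoc, ← Finset.sum_mul, h]
      simp [mul_assoc, ← Finset.mul_sum]
    · simp [hw']
  · have : f ∘ Sum.elim u (0 : Fin m' → R) = Sum.elim (f ∘ u) 0 := by
      ext i
      cases i <;> simp
    rw [this, sumElim_dotProduct_sumElim]
    simp [dotProduct, Finset.sum_mul, mul_assoc]

theorem IsRational.inv {x : Sˣ} (hx : IsRational f (x : S)) :
    IsRational f ((x⁻¹ : Sˣ) : S) := by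
  obtain ⟨m, A, u, v, h⟩ := hx
  -- Solving the bordered system with right side `(0, -1)` gives `(-w x⁻¹, x⁻¹)`; the row `(0, 1)`
  -- reads off the last entry.
  refine IsRealization.isRational (A := bordered A u v) (u := Sum.elim 0 1)
    (v := Sum.elim 0 (-1)) ⟨h.isUnit_bordered_iff.2 x.isUnit, ?_⟩
  obtain ⟨hA, w, hw, hx⟩ := h
  refine ⟨Sum.elim (fun i => - (w i * (x⁻¹ : Sˣ))) (fun _ => (x⁻¹ : Sˣ)), ?_, ?_⟩
  · rw [bordered, fromBlocks_map, fromBlocks_mulVec, Sum.comp_elim]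
    congr 1
    · ext i
      have h := congrFun hw i
      simp only [mulVec, dotProduct, Function.comp_apply, Matrix.map_apply] at h
      simp [mulVec, dotProduct, ← mul_assoc, ← Finset.sum_mul, h]
    · ext i
      have h : ∑ i, f (u i) * w i = x := by rw [hx]; rfl
      simp [mulVec, dotProduct, ← mul_assoc, ← Finset.sum_mul, h]
  · have : f ∘ Sum.elim (0 : Fin m → R) (1 : Fin 1 → R) =
        Sum.elim (0 : Fin m → S) (1 : Fin 1 → S) := by
      ext i
      cases i <;> simp
    rw [this, sumElim_dotProduct_sumElim]
    simp [dotProduct]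

/-- The data `(A, u, v)` determine `x`, and there are countably many such triples. -/
theorem countable_isRational [Countable R] (f : R →+* S) : {x | IsRational f x}.Countable := by
  let P := Σ m : ℕ, Matrix (Fin m) (Fin m) R × (Fin m → R) × (Fin m → R)
  have : ∀ m, Countable (Matrix (Fin m) (Fin m) R) := fun m =>
    inferInstanceAs (Countable (Fin m → Fin m → R))
  have : Countable P := inferInstance
  let g : P → Set S := fun p => {x | IsRealization f p.2.1 p.2.2.1 p.2.2.2 x}
  have hg : ∀ p, (g p).Subsingleton := by
    rintro ⟨m, A, u, v⟩ x ⟨hA, w, hw, rfl⟩ y ⟨-, w', hw', rfl⟩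
    obtain ⟨A', -, h2⟩ := isUnit_iff_exists.1 hA
    have := congrArg (A' *ᵥ ·) (hw.trans hw'.symm)
    simp only [mulVec_mulVec] at this
    simp only at h2
    rw [h2, one_mulVec, one_mulVec] at this
    rw [this]
  refine (Set.countable_iUnion fun p => (hg p).countable).mono ?_
  rintro x ⟨m, A, u, v, h⟩
  exact Set.mem_iUnion.2 ⟨⟨m, A, u, v⟩, h⟩

/-- The rational closure of the image of an algebra homomorphism, as a subalgebra. -/
def rationalClosure {k : Type*} [CommRing k] [Algebra k R] [Algebra k S] (f : R →ₐ[k] S) :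
    Subalgebra k S where
  carrier := {x | IsRational (f : R →+* S) x}
  mul_mem' := IsRational.mul
  add_mem' := IsRational.add
  algebraMap_mem' c := by
    have := isRational_apply (f : R →+* S) (algebraMap k R c)
    rwa [AlgHom.coe_toRingHom, f.commutes] at this

end Realization

/-! ### Rank over a skew field via full-rank factorizations. -/

section SkewRank

open Matrix

variable {D : Type*} [DivisionRing D]

/-- The rows of `Y` are a basis of the row space and `X` holds the coordinates of the rows of `A`.
The one-sided inverses make the rank visible to any rank function, after any ring homomorphism. -/
theorem exists_skewRank_factorization {m : ℕ} (A : Matrix (Fin m) (Fin m) D) :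
    ∃ (X : Matrix (Fin m) (Fin (skewRank A)) D) (Y : Matrix (Fin (skewRank A)) (Fin m) D)
      (Z : Matrix (Fin (skewRank A)) (Fin m) D) (W : Matrix (Fin m) (Fin (skewRank A)) D),
      A = X * Y ∧ Z * X = 1 ∧ Y * W = 1 := by
  let V := Submodule.span D (Set.range A.row)
  let b : Module.Basis (Fin (skewRank A)) D V := Module.finBasis D V
  let Y : Matrix (Fin (skewRank A)) (Fin m) D := of fun i => (b i : Fin m → D)
  have hA : ∀ i, A.row i ∈ V := fun i => Submodule.subset_span ⟨i, rfl⟩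
  let X : Matrix (Fin m) (Fin (skewRank A)) D := of fun i j => b.repr ⟨A.row i, hA i⟩ j
  have hXY : A = X * Y := by
    ext i j
    have h := congrFun (congrArg V.subtype (b.sum_repr ⟨A.row i, hA i⟩)) j
    rw [map_sum, Finset.sum_apply] at h
    exact h.symm
  have hli : LinearIndependent D (fun i => (b i : Fin m → D)) :=
    b.linearIndependent.map' V.subtype V.ker_subtype
  have hcancel : ∀ {p : ℕ} (P Q : Matrix (Fin p) (Fin (skewRank A)) D), P * Y = Q * Y → P = Q := by
    intro p P Q h
    ext i j
    have h1 : ∑ j, (P i j - Q i j) • (b j : Fin m → D) = 0 := by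
      ext k
      have := congrFun (congrFun h i) k
      simp only [mul_apply] at this
      simp [sub_mul, Finset.sum_sub_distrib]
      rw [sub_eq_zero]
      exact this
    exact sub_eq_zero.1 (Fintype.linearIndependent_iff.1 hli _ h1 j)
  -- The basis vectors are combinations of rows of `A`; then `Z X Y = Y`, and cancelling `Y` gives
  -- `Z X = 1`.
  have hZ : ∃ Z : Matrix (Fin (skewRank A)) (Fin m) D, Z * A = Y := by
    have : ∀ i, ∃ c : Fin m → D, ∑ j, c j • A.row j = b i := fun i =>
      (Submodule.mem_span_range_iff_exists_fun D).1 (b i).2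
    choose c hc using this
    refine ⟨of c, ?_⟩
    ext i j
    have := congrFun (hc i) j
    simpa [mul_apply, Y] using this
  obtain ⟨Z, hZ⟩ := hZ
  -- `W` is the matrix of a linear retraction of the injection `c ↦ c Y`.
  obtain ⟨g, hg⟩ := (Fintype.linearCombination D (fun i => (b i : Fin m → D))
    ).exists_leftInverse_of_injective (LinearMap.ker_eq_bot.2 hli.fintypeLinearCombination_injective)
  refine ⟨X, Y, Z, of fun j => g (Pi.single j 1), hXY, ?_, ?_⟩
  · apply hcancel
    rw [Matrix.mul_assoc, ← hXY, hZ, Matrix.one_mul]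
  · ext i j
    have h1 : g (b i : Fin m → D) = Pi.single i 1 := by
      have := LinearMap.congr_fun hg (Pi.single i 1)
      simpa [Fintype.linearCombination_apply_single] using this
    have h2 : (b i : Fin m → D) = ∑ k, (b i : Fin m → D) k • Pi.single k (1 : D) := by
      ext l
      simp [Pi.single_apply]
    rw [h2, map_sum] at h1
    have := congrFun h1 j
    simp only [map_smul, Finset.sum_apply, Pi.smul_apply, smul_eq_mul] at this
    rw [mul_apply, one_apply]
    simp only [Y, of_apply]
    rw [this, Pi.single_apply]
    simp [eq_comm]

theorem isUnit_iff_skewRank_eq {m : ℕ} (A : Matrix (Fin m) (Fin m) D) :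
    IsUnit A ↔ skewRank A = m := by
  constructor
  · intro h
    obtain ⟨B, -, hB⟩ := isUnit_iff_exists.1 h
    have : Submodule.span D (Set.range A.row) = ⊤ := by
      refine eq_top_iff.2 fun x _ => (Submodule.mem_span_range_iff_exists_fun D).2 ⟨x ᵥ* B, ?_⟩
      have h1 : (x ᵥ* B) ᵥ* A = x := by rw [vecMul_vecMul, hB, vecMul_one]
      ext j
      have := congrFun h1 j
      simpa [vecMul, dotProduct] using this
    rw [skewRank, this, finrank_top, Module.finrank_fin_fun]
  · intro h
    obtain ⟨X, Y, Z, W, hA, hZ, hW⟩ := exists_skewRank_factorization A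
    have e : Fin (skewRank A) ≃ Fin m := finCongr h
    -- At full rank the factors are square, so their one-sided inverses are two-sided.
    have hX := (mul_eq_one_comm_of_equiv e).1 hZ
    have hY := (mul_eq_one_comm_of_equiv e).1 hW
    refine isUnit_iff_exists.2 ⟨W * Z, ?_, ?_⟩
    · calc A * (W * Z) = X * Y * (W * Z) := congrArg (· * (W * Z)) hA
        _ = 1 := by rw [Matrix.mul_assoc, ← Matrix.mul_assoc Y, hW, Matrix.one_mul, hX]
    · calc W * Z * A = W * Z * (X * Y) := congrArg (W * Z * ·) hA
        _ = 1 := by rw [Matrix.mul_assoc, ← Matrix.mul_assoc Z, hZ, Matrix.one_mul, hY]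

end SkewRank

/-! ### Ranks of block matrices over a field. -/

section MatrixRank

open Matrix

/-- Von Neumann regularity: the rank normal form `V M U` is idempotent, so `B = U V` works. -/
theorem exists_mul_mul_self {K m : Type*} [Field K] [Fintype m] [DecidableEq m]
    (M : Matrix m m K) : ∃ B, M * B * M = M := by
  obtain ⟨V, U, e, hV, hU, h⟩ := exists_rank_normal_form M
  obtain ⟨V', -, hV'⟩ := isUnit_iff_exists.1 hV
  obtain ⟨U', hU', -⟩ := isUnit_iff_exists.1 hU
  have hN : (V * M * U) * (V * M * U) = V * M * U := by
    rw [h, submatrix_mul_equiv, fromBlocks_multiply]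
    simp
  refine ⟨U * V, ?_⟩
  calc M * (U * V) * M = V' * V * M * (U * V) * M * (U * U') := by
        rw [hU', hV', Matrix.one_mul, Matrix.mul_one]
    _ = V' * ((V * M * U) * (V * M * U)) * U' := by simp only [Matrix.mul_assoc]
    _ = V' * V * M * (U * U') := by rw [hN]; simp only [Matrix.mul_assoc]
    _ = M := by rw [hU', hV', Matrix.one_mul, Matrix.mul_one]

theorem rank_fromBlocks_diag {K l m o p : Type*} [Field K] [Fintype l] [Fintype m] [Fintype o]
    [Fintype p] (A : Matrix l m K) (D : Matrix o p K) :
    (fromBlocks A 0 0 D).rank = A.rank + D.rank := by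
  let φ : (A.mulVecLin.range × D.mulVecLin.range) →ₗ[K] (l ⊕ o → K) :=
    (LinearEquiv.sumArrowLequivProdArrow l o K K).symm.toLinearMap ∘ₗ
      A.mulVecLin.range.subtype.prodMap D.mulVecLin.range.subtype
  have hφ : Function.Injective φ :=
    (LinearEquiv.sumArrowLequivProdArrow l o K K).symm.injective.comp
      (Function.Injective.prodMap Subtype.val_injective Subtype.val_injective)
  have happ : ∀ a b, φ (a, b) = Sum.elim (a : l → K) (b : o → K) := fun a b => by
    ext i
    cases i <;> rfl
  have hr : (fromBlocks A 0 0 D).mulVecLin.range = φ.range := by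
    ext y
    constructor
    · rintro ⟨x, rfl⟩
      refine ⟨(⟨_, LinearMap.mem_range_self _ (x ∘ Sum.inl)⟩,
        ⟨_, LinearMap.mem_range_self _ (x ∘ Sum.inr)⟩), ?_⟩
      rw [happ]
      simp [fromBlocks_mulVec]
    · rintro ⟨⟨⟨_, x, rfl⟩, ⟨_, z, rfl⟩⟩, rfl⟩
      refine ⟨Sum.elim x z, ?_⟩
      rw [happ, mulVecLin_apply, fromBlocks_mulVec]
      simp
  rw [Matrix.rank, hr, LinearMap.finrank_range_of_inj hφ, Module.finrank_prod]
  rfl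

theorem rank_add_le_rank_add_rank {K m o : Type*} [Field K] [Finite m] [Fintype o]
    (A B : Matrix m o K) : (A + B).rank ≤ A.rank + B.rank := by
  unfold Matrix.rank
  rw [Matrix.mulVecLin_add]
  exact (Submodule.finrank_mono (LinearMap.range_add_le _ _)).trans
    (Submodule.finrank_add_le_finrank_add_finrank _ _)

theorem rank_sum_le_sum_rank {K m o α : Type*} [Field K] [Finite m] [Fintype o]
    (s : Finset α) (A : α → Matrix m o K) : (∑ a ∈ s, A a).rank ≤ ∑ a ∈ s, (A a).rank := by
  classical
  induction s using Finset.induction_on with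
  | empty => simp
  | insert a s ha ih =>
    rw [Finset.sum_insert ha, Finset.sum_insert ha]
    exact (rank_add_le_rank_add_rank _ _).trans (by gcongr)

theorem comp_mul {K l m o p : Type*} [Field K] [Fintype m] [Fintype p]
    (A : Matrix l m (Matrix p p K)) (B : Matrix m o (Matrix p p K)) :
    comp l o p p K (A * B) = comp l m p p K A * comp m o p p K B := by
  ext ⟨i, a⟩ ⟨j, b⟩
  simp [mul_apply, Fintype.sum_prod_type, Matrix.sum_apply]

theorem rank_comp_single_le {K l m p : Type*} [Field K] [Fintype l] [Fintype m] [Fintype p]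
    [DecidableEq l] [DecidableEq m] [DecidableEq p] (i : l) (j : m) (a : Matrix p p K) :
    (comp l m p p K (single i j a)).rank ≤ a.rank := by
  let P : Matrix (l × p) p K := of fun x b => if x.1 = i ∧ x.2 = b then 1 else 0
  let Q : Matrix p (m × p) K := of fun b x => if x.1 = j ∧ x.2 = b then 1 else 0
  have : comp l m p p K (single i j a) = P * a * Q := by
    ext ⟨i', b⟩ ⟨j', c⟩
    simp only [comp_apply, single_apply, mul_apply, P, Q, of_apply]
    by_cases h : i' = i <;> by_cases h' : j' = j <;>
      simp [h, h', eq_comm (a := i), eq_comm (a := j)]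
  rw [this]
  exact (rank_mul_le_left _ _).trans (rank_mul_le_right _ _)

theorem rank_comp_le_sum {K l m p : Type*} [Field K] [Fintype l] [Fintype m] [Fintype p]
    [DecidableEq p] (A : Matrix l m (Matrix p p K)) :
    (comp l m p p K A).rank ≤ ∑ i, ∑ j, (A i j).rank := by
  classical
  have h : comp l m p p K A = ∑ i, ∑ j, comp l m p p K (single i j (A i j)) := by
    conv_lhs => rw [matrix_eq_sum_single A]
    simp only [← compAddEquiv_apply, map_sum]
  rw [h]
  refine (rank_sum_le_sum_rank _ _).trans (Finset.sum_le_sum fun i _ => ?_)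
  exact (rank_sum_le_sum_rank _ _).trans (Finset.sum_le_sum fun j _ => rank_comp_single_le _ _ _)

end MatrixRank

/-! ### The rank function on matrices over the ultraproduct. -/

section UltraRank

open Matrix

variable {K : Type u} [Field K] {n : ℕ → ℕ}

/-- The normalized rank at level `k` of a matrix over the product of the matrix algebras. -/
def levelRank {ι κ : Type*} [Fintype κ] (A : Matrix ι κ (∀ k, Matrix (Fin (n k)) (Fin (n k)) K))
    (k : ℕ) : ℝ :=
  ((comp ι κ (Fin (n k)) (Fin (n k)) K (A.map fun a => a k)).rank : ℝ) / n k

variable {ι κ μ : Type*} [Fintype ι] [Fintype κ] [Fintype μ]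

theorem levelRank_nonneg {ι κ : Type*} [Fintype κ]
    (A : Matrix ι κ (∀ k, Matrix (Fin (n k)) (Fin (n k)) K)) (k : ℕ) :
    0 ≤ levelRank A k := by
  unfold levelRank
  positivity

theorem levelRank_le_card (A : Matrix ι κ (∀ k, Matrix (Fin (n k)) (Fin (n k)) K)) (k : ℕ) :
    levelRank A k ≤ Fintype.card ι := by
  refine div_le_of_le_mul₀ (Nat.cast_nonneg _) (Nat.cast_nonneg _) ?_
  have := rank_le_card_height (comp ι κ (Fin (n k)) (Fin (n k)) K (A.map fun a => a k))
  rw [Fintype.card_prod, Fintype.card_fin] at this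
  exact_mod_cast this

theorem map_eval_mul {ι κ μ : Type*} [Fintype κ]
    (A : Matrix ι κ (∀ k, Matrix (Fin (n k)) (Fin (n k)) K))
    (B : Matrix κ μ (∀ k, Matrix (Fin (n k)) (Fin (n k)) K)) (k : ℕ) :
    (A * B).map (fun a => a k) = A.map (fun a => a k) * B.map (fun a => a k) :=
  Matrix.map_mul (f := Pi.evalRingHom (fun k => Matrix (Fin (n k)) (Fin (n k)) K) k)

theorem levelRank_mul_le_left {ι : Type*} (A : Matrix ι κ (∀ k, Matrix (Fin (n k)) (Fin (n k)) K))
    (B : Matrix κ μ (∀ k, Matrix (Fin (n k)) (Fin (n k)) K)) (k : ℕ) :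
    levelRank (A * B) k ≤ levelRank A k := by
  unfold levelRank
  rw [map_eval_mul, comp_mul]
  gcongr
  exact rank_mul_le_left _ _

theorem levelRank_mul_le_right {ι : Type*} (A : Matrix ι κ (∀ k, Matrix (Fin (n k)) (Fin (n k)) K))
    (B : Matrix κ μ (∀ k, Matrix (Fin (n k)) (Fin (n k)) K)) (k : ℕ) :
    levelRank (A * B) k ≤ levelRank B k := by
  unfold levelRank
  rw [map_eval_mul, comp_mul]
  gcongr
  exact rank_mul_le_right _ _

theorem levelRank_add_le (A B : Matrix ι κ (∀ k, Matrix (Fin (n k)) (Fin (n k)) K)) (k : ℕ) :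
    levelRank (A + B) k ≤ levelRank A k + levelRank B k := by
  unfold levelRank
  rw [← add_div]
  gcongr
  exact_mod_cast rank_add_le_rank_add_rank _ _

theorem levelRank_le_sum (A : Matrix ι κ (∀ k, Matrix (Fin (n k)) (Fin (n k)) K)) (k : ℕ) :
    levelRank A k ≤ ∑ i, ∑ j, ((A i j k).rank : ℝ) / n k := by
  unfold levelRank
  simp only [← Finset.sum_div]
  gcongr
  exact_mod_cast rank_comp_le_sum (A.map fun a => a k)

theorem levelRank_one [DecidableEq ι] (hn : ∀ k, 0 < n k) (k : ℕ) :
    levelRank (1 : Matrix ι ι (∀ k, Matrix (Fin (n k)) (Fin (n k)) K)) k = Fintype.card ι := by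
  have h : (1 : Matrix ι ι (∀ k, Matrix (Fin (n k)) (Fin (n k)) K)).map (fun a => a k) = 1 :=
    Matrix.map_one (fun a : ∀ k, Matrix (Fin (n k)) (Fin (n k)) K => a k) rfl rfl
  have h0 : (n k : ℝ) ≠ 0 := by exact_mod_cast (hn k).ne'
  rw [levelRank, h, comp_one, rank_one, Fintype.card_prod, Fintype.card_fin]
  push_cast
  field_simp

theorem levelRank_fromBlocks_diag (A : Matrix ι ι (∀ k, Matrix (Fin (n k)) (Fin (n k)) K))
    (D : Matrix κ κ (∀ k, Matrix (Fin (n k)) (Fin (n k)) K)) (k : ℕ) :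
    levelRank (fromBlocks A 0 0 D) k = levelRank A k + levelRank D k := by
  unfold levelRank
  rw [← add_div, ← Nat.cast_add, ← rank_fromBlocks_diag,
    ← rank_submatrix _ (Equiv.sumProdDistrib ι κ (Fin (n k)))
      (Equiv.sumProdDistrib ι κ (Fin (n k)))]
  congr 3
  ext ⟨i | i, a⟩ ⟨j | j, b⟩ <;> simp

theorem levelRank_scalar_fin_one (x : ∀ k, Matrix (Fin (n k)) (Fin (n k)) K) (k : ℕ) :
    levelRank (scalar (Fin 1) x) k = ((x k).rank : ℝ) / n k := by
  unfold levelRank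
  rw [← rank_submatrix (x k) (Equiv.uniqueProd (Fin (n k)) (Fin 1))
    (Equiv.uniqueProd (Fin (n k)) (Fin 1))]
  congr 3
  ext ⟨i, a⟩ ⟨j, b⟩
  fin_cases i
  fin_cases j
  simp

variable {ω : Ultrafilter ℕ}

theorem tendsto_levelRank_of_mem
    {A : Matrix ι κ (∀ k, Matrix (Fin (n k)) (Fin (n k)) K)}
    (hA : ∀ i j, A i j ∈ rankIdeal K n ω) : Tendsto (levelRank A) ω (𝓝 0) := by
  refine squeeze_zero (levelRank_nonneg A) (levelRank_le_sum A) ?_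
  have : Tendsto (fun k => ∑ i, ∑ j, ((A i j k).rank : ℝ) / n k) ω (𝓝 (∑ _i : ι, ∑ _j : κ, 0)) :=
    tendsto_finsetSum _ fun i _ => tendsto_finsetSum _ fun j _ => hA i j
  simpa using this

theorem exists_tendsto_levelRank (A : Matrix ι κ (∀ k, Matrix (Fin (n k)) (Fin (n k)) K)) :
    ∃ l, Tendsto (levelRank A) ω (𝓝 l) := by
  obtain ⟨l, -, hl⟩ := (isCompact_Icc (a := (0 : ℝ)) (b := Fintype.card ι)).ultrafilter_le_nhds
    (ω.map (levelRank A)) (by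
      rw [le_principal_iff]
      exact Filter.mem_map.2 <| univ_mem' fun k => ⟨levelRank_nonneg A k, levelRank_le_card A k⟩)
  exact ⟨l, hl⟩

/-- The rank of a matrix over the ultraproduct. -/
def ultraRank (A : Matrix ι κ (Ultraproduct K n ω)) : ℝ :=
  limUnder (ω : Filter ℕ) (levelRank (A.map Quotient.out))

/-- Independence of the chosen representatives: two lifts differ by entries in `rankIdeal`, and
subadditivity bounds the difference of their ranks by quantities tending to zero. -/
theorem tendsto_ultraRank (A : Matrix ι κ (∀ k, Matrix (Fin (n k)) (Fin (n k)) K)) :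
    Tendsto (levelRank A) ω (𝓝 (ultraRank (A.map (Ideal.Quotient.mk (rankIdeal K n ω))))) := by
  let B := (A.map (Ideal.Quotient.mk (rankIdeal K n ω))).map Quotient.out
  have hB : Tendsto (levelRank B) ω (𝓝 (ultraRank (A.map (Ideal.Quotient.mk (rankIdeal K n ω))))) :=
    tendsto_nhds_limUnder (exists_tendsto_levelRank B)
  have hmk : ∀ i j, Ideal.Quotient.mk (rankIdeal K n ω) (B i j) =
      Ideal.Quotient.mk (rankIdeal K n ω) (A i j) := fun i j => Quotient.out_eq _
  have h1 : Tendsto (levelRank (A - B)) ω (𝓝 0) :=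
    tendsto_levelRank_of_mem fun i j => Ideal.Quotient.eq.1 (hmk i j).symm
  have h2 : Tendsto (levelRank (B - A)) ω (𝓝 0) :=
    tendsto_levelRank_of_mem fun i j => Ideal.Quotient.eq.1 (hmk i j)
  have h3 := hB.add h1
  have h4 := hB.sub h2
  rw [add_zero] at h3
  rw [sub_zero] at h4
  refine tendsto_of_tendsto_of_tendsto_of_le_of_le h4 h3 (fun k => ?_) (fun k => ?_)
  · have := levelRank_add_le (B - A) A k
    rw [sub_add_cancel] at this
    simp only
    linarith
  · have := levelRank_add_le (A - B) B k
    rw [sub_add_cancel] at this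
    simp only
    linarith

theorem exists_lift {ι κ : Type*} (A : Matrix ι κ (Ultraproduct K n ω)) :
    ∃ B : Matrix ι κ (∀ k, Matrix (Fin (n k)) (Fin (n k)) K),
      B.map (Ideal.Quotient.mk (rankIdeal K n ω)) = A :=
  ⟨A.map Quotient.out, by ext i j; exact Quotient.out_eq _⟩

theorem ultraRank_mul_le_left (A : Matrix ι κ (Ultraproduct K n ω))
    (B : Matrix κ μ (Ultraproduct K n ω)) : ultraRank (A * B) ≤ ultraRank A := by
  obtain ⟨A, rfl⟩ := exists_lift A
  obtain ⟨B, rfl⟩ := exists_lift B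
  rw [← Matrix.map_mul]
  exact le_of_tendsto_of_tendsto' (tendsto_ultraRank _) (tendsto_ultraRank _)
    (levelRank_mul_le_left A B)

theorem ultraRank_mul_le_right (A : Matrix ι κ (Ultraproduct K n ω))
    (B : Matrix κ μ (Ultraproduct K n ω)) : ultraRank (A * B) ≤ ultraRank B := by
  obtain ⟨A, rfl⟩ := exists_lift A
  obtain ⟨B, rfl⟩ := exists_lift B
  rw [← Matrix.map_mul]
  exact le_of_tendsto_of_tendsto' (tendsto_ultraRank _) (tendsto_ultraRank _)
    (levelRank_mul_le_right A B)

theorem ultraRank_one [DecidableEq ι] (hn : ∀ k, 0 < n k) :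
    ultraRank (1 : Matrix ι ι (Ultraproduct K n ω)) = Fintype.card ι := by
  have h := tendsto_ultraRank (ω := ω) (1 : Matrix ι ι (∀ k, Matrix (Fin (n k)) (Fin (n k)) K))
  rw [Matrix.map_one _ (map_zero _) (map_one _)] at h
  refine tendsto_nhds_unique h ?_
  rw [funext (levelRank_one (K := K) (ι := ι) hn)]
  exact tendsto_const_nhds

theorem ultraRank_mul_unit [DecidableEq κ] (A : Matrix ι κ (Ultraproduct K n ω))
    {U : Matrix κ κ (Ultraproduct K n ω)} (hU : IsUnit U) : ultraRank (A * U) = ultraRank A := by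
  obtain ⟨V, hV, -⟩ := isUnit_iff_exists.1 hU
  refine (ultraRank_mul_le_left A U).antisymm ?_
  have := ultraRank_mul_le_left (A * U) V
  rwa [Matrix.mul_assoc, hV, Matrix.mul_one] at this

theorem ultraRank_unit_mul [DecidableEq ι] (A : Matrix ι κ (Ultraproduct K n ω))
    {U : Matrix ι ι (Ultraproduct K n ω)} (hU : IsUnit U) : ultraRank (U * A) = ultraRank A := by
  obtain ⟨V, -, hV⟩ := isUnit_iff_exists.1 hU
  refine (ultraRank_mul_le_right U A).antisymm ?_
  have := ultraRank_mul_le_right V (U * A)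
  rwa [← Matrix.mul_assoc, hV, Matrix.one_mul] at this

theorem ultraRank_of_isUnit [DecidableEq ι] (hn : ∀ k, 0 < n k)
    {U : Matrix ι ι (Ultraproduct K n ω)} (hU : IsUnit U) : ultraRank U = Fintype.card ι := by
  rw [← Matrix.one_mul U, ultraRank_mul_unit _ hU, ultraRank_one hn]

theorem ultraRank_le_card [DecidableEq κ] (hn : ∀ k, 0 < n k)
    (A : Matrix ι κ (Ultraproduct K n ω)) : ultraRank A ≤ Fintype.card κ := by
  rw [← ultraRank_one (K := K) (ω := ω) hn, ← Matrix.mul_one A]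
  exact ultraRank_mul_le_right _ _

theorem ultraRank_fromBlocks_diag (A : Matrix ι ι (Ultraproduct K n ω))
    (D : Matrix κ κ (Ultraproduct K n ω)) :
    ultraRank (fromBlocks A 0 0 D) = ultraRank A + ultraRank D := by
  obtain ⟨A, rfl⟩ := exists_lift A
  obtain ⟨D, rfl⟩ := exists_lift D
  have h := tendsto_ultraRank (ω := ω) (fromBlocks A 0 0 D)
  rw [fromBlocks_map, Matrix.map_zero _ (map_zero _), Matrix.map_zero _ (map_zero _),
    funext (levelRank_fromBlocks_diag A D)] at h
  exact tendsto_nhds_unique h ((tendsto_ultraRank A).add (tendsto_ultraRank D))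

theorem tendsto_ultraRank_scalar (x : ∀ k, Matrix (Fin (n k)) (Fin (n k)) K) :
    Tendsto (fun k => ((x k).rank : ℝ) / n k) ω
      (𝓝 (ultraRank (scalar (Fin 1) (Ideal.Quotient.mk (rankIdeal K n ω) x)))) := by
  have h := tendsto_ultraRank (ω := ω) (scalar (Fin 1) x)
  rw [funext (levelRank_scalar_fin_one x)] at h
  convert h using 3
  ext i j
  fin_cases i
  fin_cases j
  simp

theorem eq_zero_of_ultraRank_scalar_eq_zero {x : Ultraproduct K n ω}
    (hx : ultraRank (scalar (Fin 1) x) = 0) : x = 0 := by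
  obtain ⟨x, rfl⟩ := Ideal.Quotient.mk_surjective x
  have h := tendsto_ultraRank_scalar (ω := ω) x
  rw [hx] at h
  exact Ideal.Quotient.eq_zero_iff_mem.2 h

/-- Levelwise quasi-inverses `y` with `x y x = x` give an inverse: `(x y - 1) x = 0` and `x (y x -
1) = 0` bound the ranks of both defects by the corank of `x`, which is asymptotically negligible. -/
theorem isUnit_of_ultraRank_scalar_eq_one (hn : ∀ k, 0 < n k) {x : Ultraproduct K n ω}
    (hx : ultraRank (scalar (Fin 1) x) = 1) : IsUnit x := by
  obtain ⟨x, rfl⟩ := Ideal.Quotient.mk_surjective x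
  have h := tendsto_ultraRank_scalar (ω := ω) x
  rw [hx] at h
  have h0 : Tendsto (fun k => 1 - ((x k).rank : ℝ) / n k) ω (𝓝 0) := by
    simpa using h.const_sub 1
  choose y hy using fun k => exists_mul_mul_self (x k)
  have key : ∀ k, ∀ z : Matrix (Fin (n k)) (Fin (n k)) K, z.rank + (x k).rank ≤ n k →
      (z.rank : ℝ) / n k ≤ 1 - ((x k).rank : ℝ) / n k := by
    intro k z hz
    have hk : (0 : ℝ) < n k := by exact_mod_cast hn k
    rw [le_sub_iff_add_le, ← add_div, div_le_one hk]
    exact_mod_cast hz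
  have h1 : x * y - 1 ∈ rankIdeal K n ω := by
    refine squeeze_zero (fun k => by positivity) (fun k => key k _ ?_) h0
    have : (x * y - 1) k * x k = 0 := by
      simp [sub_mul, hy]
    simpa using rank_add_rank_le_card_of_mul_eq_zero this
  have h2 : y * x - 1 ∈ rankIdeal K n ω := by
    refine squeeze_zero (fun k => by positivity) (fun k => key k _ ?_) h0
    have : x k * (y * x - 1) k = 0 := by
      simp [mul_sub, ← mul_assoc, hy]
    rw [add_comm]
    simpa using rank_add_rank_le_card_of_mul_eq_zero this
  refine isUnit_iff_exists.2 ⟨Ideal.Quotient.mk _ y, ?_, ?_⟩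
  · rw [← map_mul, ← map_one (Ideal.Quotient.mk (rankIdeal K n ω))]
    exact Ideal.Quotient.eq.2 h1
  · rw [← map_mul, ← map_one (Ideal.Quotient.mk (rankIdeal K n ω))]
    exact Ideal.Quotient.eq.2 h2

theorem IsRealization.ultraRank_bordered {R : Type*} [Ring R] [DecidableEq ι]
    (hn : ∀ k, 0 < n k) {f : R →+* Ultraproduct K n ω} {A : Matrix ι ι R} {u v : ι → R}
    {x : Ultraproduct K n ω} (h : IsRealization f A u v x) :
    ultraRank ((bordered A u v).map f) = Fintype.card ι + ultraRank (scalar (Fin 1) x) := by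
  obtain ⟨L, U, hL, hU, he⟩ := h.bordered_map_eq
  have hneg : scalar (Fin 1) (-x) = scalar (Fin 1) x * (-1) := by
    rw [map_neg, Matrix.mul_neg, Matrix.mul_one]
  have hunit : IsUnit (-1 : Matrix (Fin 1) (Fin 1) (Ultraproduct K n ω)) := isUnit_one.neg
  rw [he, ultraRank_mul_unit _ hU, ultraRank_unit_mul _ hL, ultraRank_fromBlocks_diag,
    ultraRank_of_isUnit hn h.1, hneg, ultraRank_mul_unit _ hunit]

theorem ultraRank_reindex [DecidableEq ι] [DecidableEq κ] (e : ι ≃ κ)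
    (A : Matrix ι ι (Ultraproduct K n ω)) :
    ultraRank (Matrix.reindex e e A) = ultraRank A := by
  obtain ⟨A, rfl⟩ := exists_lift A
  refine tendsto_nhds_unique (tendsto_ultraRank (Matrix.reindex e e A)) ?_
  refine (tendsto_ultraRank A).congr fun k => ?_
  unfold levelRank
  rw [← rank_submatrix _ (e.symm.prodCongr (Equiv.refl (Fin (n k))))
    (e.symm.prodCongr (Equiv.refl (Fin (n k))))]
  rfl

theorem isUnit_or_eq_zero_of_isRational {R : Type*} [Ring R] (hn : ∀ k, 0 < n k)
    {f : R →+* Ultraproduct K n ω}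
    (hf : ∀ (m : ℕ) (A : Matrix (Fin m) (Fin m) R), ∃ z : ℤ, ultraRank (A.map f) = z)
    {x : Ultraproduct K n ω} (hx : IsRational f x) : IsUnit x ∨ x = 0 := by
  obtain ⟨m, A, u, v, h⟩ := hx
  obtain ⟨z, hz⟩ := hf (m + 1) (Matrix.reindex finSumFinEquiv finSumFinEquiv (bordered A u v))
  have h1 := h.ultraRank_bordered hn
  rw [← ultraRank_reindex finSumFinEquiv] at h1
  have hz' : (m : ℝ) + ultraRank (scalar (Fin 1) x) = z := by
    rw [Fintype.card_fin] at h1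
    rw [← hz, ← h1]
    rfl
  have h2 : 0 ≤ ultraRank (scalar (Fin 1) x) := by
    obtain ⟨B, hB⟩ := exists_lift (scalar (Fin 1) x)
    rw [← hB]
    exact ge_of_tendsto' (tendsto_ultraRank B) (levelRank_nonneg B)
  have h3 : ultraRank (scalar (Fin 1) x) ≤ 1 := by
    simpa using ultraRank_le_card hn (scalar (Fin 1) x)
  have h4 : ultraRank (scalar (Fin 1) x) = ((z - m : ℤ) : ℝ) := by
    push_cast
    linarith
  rw [h4] at h2 h3
  have h5 : 0 ≤ z - m := by exact_mod_cast h2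
  have h6 : z - m ≤ 1 := by exact_mod_cast h3
  -- Integrality enters here: no rank strictly between `0` and `1` is possible.
  obtain h7 | h7 : z - m = 0 ∨ z - m = 1 := by omega
  · right
    apply eq_zero_of_ultraRank_scalar_eq_zero
    rw [h4, h7, Int.cast_zero]
  · left
    apply isUnit_of_ultraRank_scalar_eq_one hn
    rw [h4, h7, Int.cast_one]

/-- With `A = X Y` of inner size `skewRank A`, the rank is at most that size; `Z A W = 1` of the
same size gives the reverse bound. -/
theorem ultraRank_map_eq_skewRank {D : Type*} [DivisionRing D] (hn : ∀ k, 0 < n k)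
    (f : D →+* Ultraproduct K n ω) {m : ℕ} (A : Matrix (Fin m) (Fin m) D) :
    ultraRank (A.map f) = skewRank A := by
  obtain ⟨X, Y, Z, W, hA, hZ, hW⟩ := exists_skewRank_factorization A
  apply le_antisymm
  · have h : A.map f = X.map f * Y.map f := by rw [← Matrix.map_mul]; exact congrArg (·.map f) hA
    rw [h]
    refine (ultraRank_mul_le_left _ _).trans ((ultraRank_le_card hn _).trans ?_)
    simp
  · have h : Z.map f * (A.map f * W.map f) = 1 := by
      rw [← Matrix.map_mul, ← Matrix.map_mul, ← Matrix.map_one f (map_zero f) (map_one f)]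
      congr 1
      calc Z * (A * W) = Z * ((X * Y) * W) := congrArg (fun B => Z * (B * W)) hA
        _ = 1 := by rw [Matrix.mul_assoc X, hW, Matrix.mul_one, hZ]
    have h1 := ultraRank_one (K := K) (ω := ω) (ι := Fin (skewRank A)) hn
    rw [← h, Fintype.card_fin] at h1
    rw [← h1]
    exact (ultraRank_mul_le_right _ _).trans (ultraRank_mul_le_left _ _)

end UltraRank

/-! ### Skew fields generated by a ring are determined by which matrices become invertible. -/

section Comparison

variable {K : Type*} [Field K] {R : Type*} [Ring R] [Algebra K R]

theorem surjective_of_closure_eq_top {D S : Type*} [DivisionRing D] [Algebra K D] [Ring S]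
    [Algebra K S] {f : R →ₐ[K] D} (hf : Subfield.closure (Set.range f) = ⊤) (p : S →ₐ[K] D)
    (hfp : ∀ r, f r ∈ p.range) (hinv : ∀ s, p s ≠ 0 → ∃ t, p t = (p s)⁻¹) :
    Function.Surjective p := by
  -- The range of `p` is closed under inverses, so it is a skew subfield containing the generators.
  let L : Subfield D :=
    { p.range.toSubring with
      inv_mem' := by
        rintro _ ⟨s, rfl⟩
        by_cases h : p s = 0
        · exact ⟨s, by simp [h]⟩
        · exact hinv s h }
  have hL : Subfield.closure (Set.range f) ≤ L :=
    Subfield.closure_le.2 (Set.range_subset_iff.2 hfp)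
  rw [hf] at hL
  exact fun x => hL (Subfield.mem_top x)

theorem exists_algEquiv_of_isUnit_iff {D D' : Type*} [DivisionRing D] [Algebra K D]
    [DivisionRing D'] [Algebra K D'] (f : R →ₐ[K] D) (f' : R →ₐ[K] D')
    (h : ∀ (m : ℕ) (A : Matrix (Fin m) (Fin m) R), IsUnit (A.map f) ↔ IsUnit (A.map f'))
    (hf : Subfield.closure (Set.range f) = ⊤) (hf' : Subfield.closure (Set.range f') = ⊤) :
    ∃ π : D ≃ₐ[K] D', ∀ r, π (f r) = f' r := by
  -- `Γ` will be the graph of the isomorphism: both projections turn out to be bijective.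
  let Γ := rationalClosure (f.prod f')
  let p : Γ →ₐ[K] D := (AlgHom.fst K D D').comp Γ.val
  let p' : Γ →ₐ[K] D' := (AlgHom.snd K D D').comp Γ.val
  -- One bordered matrix over `R` tests both coordinates, and by `h` it is invertible over `D`
  -- exactly when it is over `D'`.
  have hzero : ∀ s, p s ≠ 0 ↔ p' s ≠ 0 := by
    rintro ⟨x, hx⟩
    obtain ⟨m, A, u, v, hr⟩ := hx
    have h1 := h (m + 1) (Matrix.reindex finSumFinEquiv finSumFinEquiv (bordered A u v))
    rw [isUnit_map_reindex_iff, isUnit_map_reindex_iff] at h1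
    rw [← isUnit_iff_ne_zero, ← isUnit_iff_ne_zero]
    exact (hr.map (RingHom.fst D D')).isUnit_bordered_iff.symm.trans
      (h1.trans (hr.map (RingHom.snd D D')).isUnit_bordered_iff)
  have hinv : ∀ s, p s ≠ 0 → ∃ t, p t = (p s)⁻¹ ∧ p' t = (p' s)⁻¹ := by
    intro s hs
    have hs' := (hzero s).1 hs
    -- With both coordinates nonzero, `s` is a unit of `D × D'`, and `Γ` is closed under inverses of
    -- units.
    let y : (D × D')ˣ := ⟨s, ((p s)⁻¹, (p' s)⁻¹), Prod.ext (mul_inv_cancel₀ hs)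
      (mul_inv_cancel₀ hs'), Prod.ext (inv_mul_cancel₀ hs) (inv_mul_cancel₀ hs')⟩
    exact ⟨⟨_, IsRational.inv (x := y) s.2⟩, rfl, rfl⟩
  have hmem : ∀ r, f.prod f' r ∈ Γ := fun r => isRational_apply _ r
  have hp : Function.Bijective p := by
    refine ⟨(injective_iff_map_eq_zero p).2 fun s hs => Subtype.ext (Prod.ext hs ?_),
      surjective_of_closure_eq_top hf p (fun r => ⟨⟨_, hmem r⟩, rfl⟩) fun s hs => ?_⟩
    · by_contra h'
      exact (hzero s).2 h' hs
    · exact (hinv s hs).imp fun t ht => ht.1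
  have hp' : Function.Bijective p' := by
    refine ⟨(injective_iff_map_eq_zero p').2 fun s hs => Subtype.ext (Prod.ext ?_ hs),
      surjective_of_closure_eq_top hf' p' (fun r => ⟨⟨_, hmem r⟩, rfl⟩) fun s hs => ?_⟩
    · by_contra h'
      exact (hzero s).1 h' hs
    · exact (hinv s ((hzero s).2 hs)).imp fun t ht => ht.2
  refine ⟨(AlgEquiv.ofBijective p hp).symm.trans (AlgEquiv.ofBijective p' hp'), fun r => ?_⟩
  have : (AlgEquiv.ofBijective p hp).symm (f r) = ⟨_, hmem r⟩ :=
    (AlgEquiv.symm_apply_eq _).2 rfl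
  rw [AlgEquiv.trans_apply, this]
  rfl

end Comparison

/-! ### Uniqueness of generating limits. -/

section Extend

theorem extend_apply_of {K : Type*} [Field K] {G A : Type*} [Group G] [Ring A] [Algebra K A]
    (θ : G →* Aˣ) (g : G) : extend K θ (MonoidAlgebra.of K G g) = θ g := by
  simp [extend]

variable {K : Type*} [Field K] {G : Type*} [Group G] {n : ℕ → ℕ}

theorem IsLimit.exists_algEquiv {θ : ∀ k, G →* (Matrix (Fin (n k)) (Fin (n k)) K)ˣ}
    {D D' : Type*} [DivisionRing D] [Algebra K D] [DivisionRing D'] [Algebra K D']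
    {ρ : G →* Dˣ} {ρ' : G →* D'ˣ} (h : IsLimit θ ρ) (hρ : Generates K ρ)
    (h' : IsLimit θ ρ') (hρ' : Generates K ρ') :
    ∃ π : D ≃ₐ[K] D', ∀ g, π (ρ g : D) = (ρ' g : D') := by
  obtain ⟨π, hπ⟩ := exists_algEquiv_of_isUnit_iff (extend K ρ) (extend K ρ')
    (fun m A => by
      have := tendsto_nhds_unique (h m A) (h' m A)
      rw [isUnit_iff_skewRank_eq, isUnit_iff_skewRank_eq, Nat.cast_injective this]) hρ hρ'
  refine ⟨π, fun g => ?_⟩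
  have := hπ (MonoidAlgebra.of K G g)
  rwa [extend_apply_of, extend_apply_of] at this

end Extend

/-! ### The division closure as a skew field generated by the group. -/

section DivisionClosure

variable {K : Type*} [Field K] {S : Type*} [Ring S] [Algebra K S] {X : Set S}

theorem subset_divisionClosure : X ⊆ divisionClosure K X := fun _ hx =>
  Algebra.mem_sInf.2 fun _ hT => hT.1 hx

theorem inv_mem_divisionClosure {x : Sˣ} (hx : (x : S) ∈ divisionClosure K X) :
    ((x⁻¹ : Sˣ) : S) ∈ divisionClosure K X :=
  Algebra.mem_sInf.2 fun T hT => hT.2 x (Algebra.mem_sInf.1 hx T hT)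

theorem divisionClosure_le {T : Subalgebra K S} (hX : X ⊆ T)
    (hT : ∀ x : Sˣ, (x : S) ∈ T → ((x⁻¹ : Sˣ) : S) ∈ T) : divisionClosure K X ≤ T :=
  sInf_le ⟨hX, hT⟩

theorem divisionClosure_range_le_rationalClosure {R : Type*} [Ring R] [Algebra K R]
    (f : R →ₐ[K] S) : divisionClosure K (Set.range f) ≤ rationalClosure f :=
  divisionClosure_le (Set.range_subset_iff.2 fun r => isRational_apply (f : R →+* S) r)
    fun _ hx => IsRational.inv hx

theorem isUnit_or_eq_zero_of_divisionClosure
    (h : ∀ x ∈ divisionClosure K X, IsUnit x ∨ x = 0) (x : divisionClosure K X) :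
    IsUnit x ∨ x = 0 := by
  obtain hx | hx := h x x.2
  · obtain ⟨y, hy⟩ := hx
    refine .inl (isUnit_iff_exists.2 ⟨⟨(y⁻¹ : Sˣ), inv_mem_divisionClosure (hy ▸ x.2)⟩, ?_, ?_⟩)
    · exact Subtype.ext (by simp [← hy])
    · exact Subtype.ext (by simp [← hy])
  · exact .inr (Subtype.ext hx)

/-- A division closure in which every nonzero element is a unit of the ambient ring is a skew
field. -/
abbrev divisionClosureDivisionRing [Nontrivial S]
    (h : ∀ x ∈ divisionClosure K X, IsUnit x ∨ x = 0) : DivisionRing (divisionClosure K X) :=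
  DivisionRing.ofIsUnitOrEqZero (isUnit_or_eq_zero_of_divisionClosure h)

variable {G : Type*} [Group G]

/-- A homomorphism into the units of `S`, as a homomorphism into the units of the division closure
of the image of the group algebra. -/
def divisionClosureRep (θ : G →* Sˣ) :
    G →* (divisionClosure K (Set.range (extend K θ)))ˣ :=
  MonoidHom.toHomUnits <| ((Units.coeHom S).comp θ).codRestrict
    (divisionClosure K (Set.range (extend K θ))) fun g =>
      subset_divisionClosure ⟨MonoidAlgebra.of K G g, extend_apply_of θ g⟩

theorem coe_extend_divisionClosureRep (θ : G →* Sˣ) (a : MonoidAlgebra K G) :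
    (extend K (divisionClosureRep (K := K) θ) a : S) = extend K θ a := by
  have : (divisionClosure K (Set.range (extend K θ))).val.comp
      (extend K (divisionClosureRep (K := K) θ)) = extend K θ := by
    refine MonoidAlgebra.algHom_ext (fun g => ?_) (Subsingleton.elim _ _)
    rw [AlgHom.comp_apply, ← MonoidAlgebra.of_apply, extend_apply_of, extend_apply_of]
    rfl
  exact DFunLike.congr_fun this a

theorem generates_divisionClosureRep [Nontrivial S] (θ : G →* Sˣ)
    (h : ∀ x ∈ divisionClosure K (Set.range (extend K θ)), IsUnit x ∨ x = 0) :
    letI := divisionClosureDivisionRing h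
    Generates K (divisionClosureRep (K := K) θ) := by
  let := divisionClosureDivisionRing h
  let T := divisionClosure K (Set.range (extend K θ))
  let L := Subfield.closure (Set.range (extend K (divisionClosureRep (K := K) θ)))
  have hL : ∀ a, extend K (divisionClosureRep (K := K) θ) a ∈ L := fun a =>
    Subfield.subset_closure ⟨a, rfl⟩
  let L' : Subalgebra K T :=
    { L.toSubring with
      algebraMap_mem' := fun c => by
        have := hL (algebraMap K _ c)
        rwa [AlgHom.commutes] at this }
  -- The image of `L'` in `S` contains the generators and is closed under inverses of units of `S`,
  -- so minimality of the division closure applies.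
  have hT : T ≤ L'.map T.val := by
    refine divisionClosure_le ?_ ?_
    · rintro _ ⟨a, rfl⟩
      exact ⟨_, hL a, coe_extend_divisionClosureRep θ a⟩
    · rintro x ⟨y, hy, hyx⟩
      have hx : (x : S) ∈ T := hyx ▸ y.2
      refine ⟨⟨_, inv_mem_divisionClosure hx⟩, ?_, rfl⟩
      have h1 : y * ⟨_, inv_mem_divisionClosure hx⟩ = 1 := Subtype.ext (by
        have : (y : S) = x := hyx
        simp [this])
      have h2 := eq_inv_of_mul_eq_one_right h1
      rw [h2]
      exact L.inv_mem hy
  refine eq_top_iff.2 fun x _ => ?_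
  obtain ⟨y, hy, hyx⟩ := hT x.2
  have : y = x := Subtype.ext hyx
  exact this ▸ hy

end DivisionClosure

/-! ### The division closure in the ultraproduct is a limit. -/

section Existence

variable {K : Type u} [Field K] {n : ℕ → ℕ} {ω : Ultrafilter ℕ} {G : Type*} [Group G]

theorem nontrivial_ultraproduct (hn : ∀ k, 0 < n k) : Nontrivial (Ultraproduct K n ω) := by
  refine ⟨1, 0, fun h => ?_⟩
  have h1 := ultraRank_one (K := K) (ω := ω) (ι := Fin 1) hn
  have h0 : ultraRank (0 : Matrix (Fin 1) (Fin 1) (Ultraproduct K n ω)) = 0 := by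
    have := tendsto_ultraRank (ω := ω)
      (0 : Matrix (Fin 1) (Fin 1) (∀ k, Matrix (Fin (n k)) (Fin (n k)) K))
    rw [Matrix.map_zero _ (map_zero _)] at this
    exact tendsto_nhds_unique this (tendsto_levelRank_of_mem fun i j => zero_mem _)
  have : (1 : Matrix (Fin 1) (Fin 1) (Ultraproduct K n ω)) = 0 := by
    ext i j
    fin_cases i
    fin_cases j
    simpa using h
  rw [this, h0] at h1
  simp at h1

theorem extend_ultraproductRep (θ : ∀ k, G →* (Matrix (Fin (n k)) (Fin (n k)) K)ˣ)
    (a : MonoidAlgebra K G) : extend K (ultraproductRep ω θ) a =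
      Ideal.Quotient.mk (rankIdeal K n ω) fun k => extend K (θ k) a := by
  have : extend K (ultraproductRep ω θ) = (Ideal.Quotient.mkₐ K (rankIdeal K n ω)).comp
      (AlgHom.pi fun k => extend K (θ k)) := by
    refine MonoidAlgebra.algHom_ext (fun g => ?_) (Subsingleton.elim _ _)
    simp only [extend, AlgHom.comp_apply, MonoidAlgebra.lift_single, one_smul]
    rw [Ideal.Quotient.mkₐ_eq_mk]
    refine congrArg (Ideal.Quotient.mk (rankIdeal K n ω)) ?_
    ext1 k
    simp
  rw [this]
  rfl

theorem tendsto_normalizedRank (θ : ∀ k, G →* (Matrix (Fin (n k)) (Fin (n k)) K)ˣ) {m : ℕ}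
    (A : Matrix (Fin m) (Fin m) (MonoidAlgebra K G)) :
    Tendsto (fun k => normalizedRank (θ k) A) ω
      (𝓝 (ultraRank (A.map (extend K (ultraproductRep ω θ))))) := by
  have h := tendsto_ultraRank (ω := ω) (A.map fun a k => extend K (θ k) a)
  rw [Matrix.map_map] at h
  rw [show ⇑(extend K (ultraproductRep ω θ)) = _ from funext (extend_ultraproductRep θ)]
  exact h

/-- A nonprincipal `ω` refines `atTop`, so the ultralimit equals the ordinary limit, which the
Atiyah condition makes an integer. -/
theorem tendsto_atTop_normalizedRank (hω : (ω : Filter ℕ) ≤ cofinite)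
    {θ : ∀ k, G →* (Matrix (Fin (n k)) (Fin (n k)) K)ˣ} (hθ : AtiyahCondition θ) {m : ℕ}
    (A : Matrix (Fin m) (Fin m) (MonoidAlgebra K G)) :
    (∃ z : ℤ, ultraRank (A.map (extend K (ultraproductRep ω θ))) = z) ∧
    Tendsto (fun k => normalizedRank (θ k) A) atTop
      (𝓝 (ultraRank (A.map (extend K (ultraproductRep ω θ))))) := by
  obtain ⟨z, hz⟩ := hθ m A
  have h : ultraRank (A.map (extend K (ultraproductRep ω θ))) = z :=
    tendsto_nhds_unique (tendsto_normalizedRank θ A) (hz.mono_left (Nat.cofinite_eq_atTop ▸ hω))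
  exact ⟨⟨z, h⟩, h ▸ hz⟩

theorem isUnit_or_eq_zero_of_mem_divisionClosure (hn : ∀ k, 0 < n k)
    (hω : (ω : Filter ℕ) ≤ cofinite) {θ : ∀ k, G →* (Matrix (Fin (n k)) (Fin (n k)) K)ˣ}
    (hθ : AtiyahCondition θ) (x : Ultraproduct K n ω)
    (hx : x ∈ divisionClosure K (Set.range (extend K (ultraproductRep ω θ)))) :
    IsUnit x ∨ x = 0 :=
  isUnit_or_eq_zero_of_isRational hn (fun _ A => (tendsto_atTop_normalizedRank hω hθ A).1)
    (divisionClosure_range_le_rationalClosure _ hx)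

theorem isLimit_divisionClosureRep [Nontrivial (Ultraproduct K n ω)] (hn : ∀ k, 0 < n k)
    (hω : (ω : Filter ℕ) ≤ cofinite) {θ : ∀ k, G →* (Matrix (Fin (n k)) (Fin (n k)) K)ˣ}
    (hθ : AtiyahCondition θ) :
    letI := divisionClosureDivisionRing (isUnit_or_eq_zero_of_mem_divisionClosure hn hω hθ)
    IsLimit θ (divisionClosureRep (K := K) (ultraproductRep ω θ)) := by
  let := divisionClosureDivisionRing (isUnit_or_eq_zero_of_mem_divisionClosure hn hω hθ)
  intro m A
  have h := (tendsto_atTop_normalizedRank hω hθ A).2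
  let f : divisionClosure K (Set.range (extend K (ultraproductRep ω θ))) →+* Ultraproduct K n ω :=
    (divisionClosure K (Set.range (extend K (ultraproductRep ω θ)))).val
  have h1 : A.map (extend K (ultraproductRep ω θ)) =
      (A.map (extend K (divisionClosureRep (K := K) (ultraproductRep ω θ)))).map f := by
    ext i j : 2
    exact (coe_extend_divisionClosureRep _ _).symm
  rw [h1, ultraRank_map_eq_skewRank hn] at h
  exact h

end Existence

end FreeGroupLimit

end

theorem theorem2 {K : Type u} [Field K] [Finite K] {r : ℕ} {n : ℕ → ℕ}
    (hn : ∀ k, 0 < n k)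
    (θ : ∀ k, FreeGroup (Fin r) →* (Matrix (Fin (n k)) (Fin (n k)) K)ˣ)
    (hconv : FreeGroupLimit.IsConvergent θ)
    (hAtiyah : FreeGroupLimit.AtiyahCondition θ) :
    ∃ (D : Type u) (_ : DivisionRing D) (_ : Algebra K D) (ρ : FreeGroup (Fin r) →* Dˣ),
      Countable D ∧
      FreeGroupLimit.IsLimit θ ρ ∧
      FreeGroupLimit.Generates K ρ ∧
      -- uniqueness of the generating limit in a skew field
      (∀ (D' : Type v) [DivisionRing D'] [Algebra K D'] (ρ' : FreeGroup (Fin r) →* D'ˣ),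
        FreeGroupLimit.IsLimit θ ρ' → FreeGroupLimit.Generates K ρ' →
          ∃ π : D ≃ₐ[K] D', ∀ g, π (ρ g : D) = (ρ' g : D')) ∧
      -- `D` is the division closure of the image of the group algebra in every ultraproduct
      -- along a nonprincipal ultrafilter
      (∀ ω : Ultrafilter ℕ, (ω : Filter ℕ) ≤ Filter.cofinite →
        ∃ e : D ≃ₐ[K] FreeGroupLimit.divisionClosure K
            (Set.range (FreeGroupLimit.extend K (FreeGroupLimit.ultraproductRep ω θ))),
          ∀ g, (e (ρ g : D) : FreeGroupLimit.Ultraproduct K n ω) =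
            FreeGroupLimit.ultraproductRep ω θ g) := by
  -- Any nonprincipal ultrafilter serves to construct `D`.
  have hω₀ : (hyperfilter ℕ : Filter ℕ) ≤ cofinite := hyperfilter_le_cofinite
  have := FreeGroupLimit.nontrivial_ultraproduct (K := K) (ω := hyperfilter ℕ) hn
  let := FreeGroupLimit.divisionClosureDivisionRing
    (FreeGroupLimit.isUnit_or_eq_zero_of_mem_divisionClosure hn hω₀ hAtiyah)
  have hlim := FreeGroupLimit.isLimit_divisionClosureRep hn hω₀ hAtiyah
  have hgen := FreeGroupLimit.generates_divisionClosureRep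
    (FreeGroupLimit.ultraproductRep (hyperfilter ℕ) θ)
    (FreeGroupLimit.isUnit_or_eq_zero_of_mem_divisionClosure hn hω₀ hAtiyah)
  refine ⟨FreeGroupLimit.divisionClosure K (Set.range
    (FreeGroupLimit.extend K (FreeGroupLimit.ultraproductRep (hyperfilter ℕ) θ))),
    inferInstance, inferInstance, FreeGroupLimit.divisionClosureRep _, ?_, hlim, hgen,
    fun D' _ _ ρ' hlim' hgen' => hlim.exists_algEquiv hgen hlim' hgen', fun ω hω => ?_⟩
  -- The group algebra of `FreeGroup (Fin r)` over a finite field is countable, hence so is its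
  -- rational closure, which contains `D`.
  · have : Countable (MonoidAlgebra K (FreeGroup (Fin r))) :=
      have : Countable (FreeGroup (Fin r)) := inferInstanceAs (Countable (Quot _))
      MonoidAlgebra.coeff_injective.countable
    exact ((FreeGroupLimit.countable_isRational _).mono
      (FreeGroupLimit.divisionClosure_range_le_rationalClosure _)).to_subtype
  -- The division closure for `ω` is another generating limit, so uniqueness supplies `e`.
  · have := FreeGroupLimit.nontrivial_ultraproduct (K := K) (ω := ω) hn
    let := FreeGroupLimit.divisionClosureDivisionRing
      (FreeGroupLimit.isUnit_or_eq_zero_of_mem_divisionClosure hn hω hAtiyah)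
    have hlim' := FreeGroupLimit.isLimit_divisionClosureRep hn hω hAtiyah
    have hgen' := FreeGroupLimit.generates_divisionClosureRep
      (FreeGroupLimit.ultraproductRep ω θ)
      (FreeGroupLimit.isUnit_or_eq_zero_of_mem_divisionClosure hn hω hAtiyah)
    obtain ⟨e, he⟩ := hlim.exists_algEquiv hgen hlim' hgen'
    exact ⟨e, fun g => by rw [he]; rfl⟩
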